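/- Let $k$ be an algebraically closed field and let $A$ be a basic connected finite dimensional $k$-algebra; modules are finitely generated left modules. (An algebra is basic if, as a left module over itself, it is basic; a module is basic if it is a finite direct sum of pairwise non-isomorphic indecomposable modules.) For a finite dimensional $k$-algebra $R$, a tilting $R$-module is a module $T$ such that (1) $T$ has finite projective dimension, (2) $\mathrm{Ext}^i_R(T,T)=0$ for all $i\geq 1$, and (3) there is an exact sequence $0\to R\to T_0\to\cdots\to T_r\to 0$ with all $T_j\in\mathrm{add}(T)$, that is, direct summands of finite direct sums of copies of $T$. Order the set of isomorphism classes of basic tilting $R$-modules by $T\leq T'$ if and only if $T^{\perp}\subseteq T'^{\perp}$, where $T^{\perp}$ is the class of modules $X$ with $\mathrm{Ext}_R^i(T,X)=0$ for all $i\geq 1$. Let $\overrightarrow{\mathcal K}_R$ be the Hasse diagram of this poset: the quiver whose vertices are these isomorphism classes, with exactly one arrow $T\to T'$ if $T'<T$ and no class lies strictly between them, and no arrow otherwise. The convex hull of a set of vertices of a quiver is the full subquiver on the smallest set of vertices that contains the given ones and contains every vertex lying on an oriented path between two of its members. Let $T$ be a basic tilting $A$-module and let $B=\mathrm{End}_A(T)$,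 acting on the left on $T$ by $f\cdot t=f(t)$ and on $\mathrm{Hom}_A(X,T)$ by composition, for every $A$-module $X$. Then $A$ is a basic tilting $A$-module, and $B$ and $T$ are basic tilting $B$-modules. Let $\overrightarrow{\mathcal K}_A(T)$ be the convex hull of $\{A,T\}$ in $\overrightarrow{\mathcal K}_A$ and let $\overrightarrow{\mathcal K}_B(T)$ be the convex hull of $\{B,T\}$ in $\overrightarrow{\mathcal K}_B$. Then $\mathrm{Hom}_A(X,T)$ is a basic tilting $B$-module for every vertex $X$ of $\overrightarrow{\mathcal K}_A(T)$, and there is an isomorphism of quivers $$\overrightarrow{\mathcal K}_A(T)\xrightarrow{\ \sim\ }\overrightarrow{\mathcal K}_B(T)^{op},\qquad X\longmapsto \mathrm{Hom}_A(X,T),$$ where $op$ reverses all arrows. It sends the vertex $A$ to the vertex $T$, and the vertex $T$ to the vertex $B$. -/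

import Mathlib

open CategoryTheory

universe u v

namespace TiltingQuiver

section Quivers

variable {V : Type v} [Quiver V]

/-- A set of vertices is convex if every oriented path between two of its vertices
passes only through vertices of the set. -/
def IsConvexSet (S : Set V) : Prop :=
  ∀ ⦃a b x : V⦄, a ∈ S → b ∈ S → Nonempty (Quiver.Path a x) → Nonempty (Quiver.Path x b) → x ∈ S

/-- The vertices of the convex hull of `S`: the smallest convex set of vertices containing `S`. -/
def hullSet (S : Set V) : Set V := ⋂₀ {C : Set V | S ⊆ C ∧ IsConvexSet C}

/-- The convex hull of a set `S` of vertices, as a type of vertices. -/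
def ConvexHull (S : Set V) : Type v := {x : V // x ∈ hullSet S}

/-- The convex hull is a full subquiver. -/
instance (S : Set V) : Quiver (ConvexHull S) where
  Hom a b := a.1 ⟶ b.1

theorem subset_hullSet (S : Set V) : S ⊆ hullSet S :=
  fun _ hx _ hC => hC.1 hx

/-- A morphism of quivers is an isomorphism if it has a two-sided inverse. -/
def IsQuiverIso {W : Type v} [Quiver W] (F : V ⥤q W) : Prop :=
  ∃ G : W ⥤q V, F ⋙q G = 𝟭q V ∧ G ⋙q F = 𝟭q W

end Quivers

section Modules

variable (R : Type u) [Ring R]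

/-- A ring is connected if its only central idempotents are `0` and `1`. -/
def IsConnectedRing : Prop :=
  ∀ e : R, IsIdempotentElem e → (∀ a : R, Commute e a) → e = 0 ∨ e = 1

variable (M : Type u) [AddCommGroup M] [Module R M]

/-- A module is indecomposable if it is nonzero and has no nontrivial direct sum decomposition. -/
def IsIndecomposable : Prop :=
  Nontrivial M ∧ ∀ p q : Submodule R M, IsCompl p q → p = ⊥ ∨ q = ⊥

/-- A module is basic if it is a finite direct sum of pairwise non-isomorphic indecomposable
modules. -/
def IsBasic : Prop :=
  ∃ (n : ℕ) (N : Fin n → Submodule R M), DirectSum.IsInternal N ∧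
    (∀ i, IsIndecomposable R (N i)) ∧ ∀ i j, i ≠ j → IsEmpty (N i ≃ₗ[R] N j)

variable (T : Type u) [AddCommGroup T] [Module R T]

/-- `M` belongs to `add T`: it is a direct summand of a finite direct sum of copies of `T`. -/
def InAdd : Prop :=
  ∃ (m : ℕ) (i : M →ₗ[R] (Fin m → T)) (p : (Fin m → T) →ₗ[R] M), p ∘ₗ i = LinearMap.id

/-- There is a finite exact sequence `0 → R → C 0 → C 1 → ⋯ → C r → 0` with all `C i` in
`add T` (we put `C i = 0` for `i > r`). -/
def HasAddCoresolution : Prop :=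
  ∃ (C : ℕ → ModuleCat.{u} R) (ι : R →ₗ[R] C 0) (d : ∀ i, C i →ₗ[R] C (i + 1)) (r : ℕ),
    Function.Injective ι ∧ Function.Exact ι (d 0) ∧ (∀ i, Function.Exact (d i) (d (i + 1))) ∧
    (∀ i, InAdd R (C i) T) ∧ ∀ i, r < i → Subsingleton (C i)

/-- Tilting modules of arbitrary finite projective dimension. Over a finite dimensional algebra,
finite dimensional modules are the same as finitely generated modules. -/
structure IsTilting : Prop where
  finite : Module.Finite R T
  finite_projectiveDimension : ∃ n : ℕ, HasProjectiveDimensionLE (ModuleCat.of R T) n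
  selforthogonal : ∀ i : ℕ, 1 ≤ i →
    Subsingleton (Abelian.Ext.{u} (ModuleCat.of R T) (ModuleCat.of R T) i)
  coresolution : HasAddCoresolution R T

/-- Basic tilting modules. -/
structure IsBasicTilting : Prop where
  isTilting : IsTilting R T
  isBasic : IsBasic R T

end Modules

section Poset

variable (R : Type u) [Ring R]

/-- The collection of all basic tilting modules. -/
def BasicTiltingModule : Type (u + 1) := {M : ModuleCat.{u} R // IsBasicTilting R M}

/-- Isomorphism of basic tilting modules. -/
instance basicTiltingSetoid : Setoid (BasicTiltingModule R) where
  r M N := Nonempty (M.1 ≃ₗ[R] N.1)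
  iseqv :=
    { refl := fun _ => ⟨LinearEquiv.refl R _⟩
      symm := fun ⟨e⟩ => ⟨e.symm⟩
      trans := fun ⟨e⟩ ⟨f⟩ => ⟨e.trans f⟩ }

/-- The set of basic tilting modules up to isomorphism. -/
def TiltingClass : Type (u + 1) := Quotient (basicTiltingSetoid R)

/-- The isomorphism class of a basic tilting module. -/
def TiltingClass.mk (T : Type u) [AddCommGroup T] [Module R T] (h : IsBasicTilting R T) :
    TiltingClass R :=
  Quotient.mk (basicTiltingSetoid R) ⟨ModuleCat.of R T, h⟩

variable {R}

/-- The right perpendicular category `M^⊥`: the finitely generated modules `X` such that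
`Ext^i(M, X) = 0` for all `i ≥ 1`. -/
def perp (M : ModuleCat.{u} R) : Set (ModuleCat.{u} R) :=
  {X | Module.Finite R X ∧ ∀ i : ℕ, 1 ≤ i → Subsingleton (Abelian.Ext.{u} M X i)}

theorem perp_subset_of_iso {M N : ModuleCat.{u} R} (e : M ≅ N) : perp M ⊆ perp N := by
  rintro X ⟨hX, h⟩
  refine ⟨hX, fun i hi => ⟨fun a b => ?_⟩⟩
  have key : ∀ c : Abelian.Ext.{u} N X i, (Abelian.Ext.mk₀ e.inv).comp
      ((Abelian.Ext.mk₀ e.hom).comp c (zero_add i)) (zero_add i) = c := by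
    intro c
    rw [← Abelian.Ext.comp_assoc (Abelian.Ext.mk₀ e.inv) (Abelian.Ext.mk₀ e.hom) c
      (zero_add 0) (zero_add i) (by omega)]
    simp
  rw [← key a, ← key b, (h i hi).elim ((Abelian.Ext.mk₀ e.hom).comp a (zero_add i))]

theorem perp_eq_of_iso {M N : ModuleCat.{u} R} (e : M ≅ N) : perp M = perp N :=
  Set.Subset.antisymm (perp_subset_of_iso e) (perp_subset_of_iso e.symm)

/-- The right perpendicular category of an isomorphism class of basic tilting modules. -/
def TiltingClass.perp (a : TiltingClass R) : Set (ModuleCat.{u} R) :=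
  Quotient.lift (fun M : BasicTiltingModule R => TiltingQuiver.perp M.1)
    (fun M N (h : Nonempty (M.1 ≃ₗ[R] N.1)) => h.elim fun e => perp_eq_of_iso e.toModuleIso) a

/-- The order on the set of basic tilting modules: `a ≤ b` if and only if `a^⊥ ⊆ b^⊥`. -/
instance : Preorder (TiltingClass R) := Preorder.lift TiltingClass.perp

/-- The Hasse diagram of the poset of basic tilting modules: there is exactly one arrow `a ⟶ b`
if `b < a` and nothing lies strictly in between, and no arrow otherwise. -/
instance : Quiver.{0} (TiltingClass R) where
  Hom a b := PLift (b ⋖ a)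

end Poset

end TiltingQuiver

/-!
The functor `X ↦ Hom_A(X, T)` sends `A`-modules to modules over `B = End_A(T)`. The isomorphism of
quivers comes from an order reversing bijection, given by this functor, between the basic tilting
`A`-modules above `T` and the basic tilting `B`-modules above `T`, with inverse `Hom_B(-, T)`.

A coresolution `0 → A → T_0 → ⋯ → T_r → 0` in `add T` dualizes to a projective resolution of `T`
over `B`. Hence `T` has finite projective dimension and no higher self-extensions over `B`, and
`A = End_B(T)` (`IsTilting.isTiltingBimodule`); from here on the situation is symmetric in `A` and
`B`. The induction behind this is the closure of the modules on which duality behaves well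
(`IsDualizable`) under kernels of epimorphisms; closure under cokernels shows that every finitely
generated module of finite projective dimension without higher extensions by `T` is dualizable
(`IsTiltingBimodule.isDualizable`). On such modules duality preserves the vanishing of higher
extensions, exchanging the two arguments (`IsTiltingBimodule.extOrthogonal_dual`).

For tilting modules, `X ≤ X'` holds exactly when all higher extensions of `X'` by `X` vanish
(`TiltingClass.mk_le_mk_iff`), so duality reverses the order. If `T ≤ X`, then `T` has a finite
resolution in `add X`, which dualizes to a coresolution of `B` in `add Hom_A(X, T)`; therefore
`Hom_A(X, T)` is tilting (`IsTiltingBimodule.isTilting_dual`). It is basic since duality is fully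
faithful on modules that agree with their double duals (`IsBasic.dual`).

The classes above `T` form an upper set of the poset, so covers and oriented paths between them are
detected inside it, and an order reversing bijection of such upper sets matches convex hulls
(`mem_hullSet_of_orderIso`). The class of `A` is the largest one and has dual `T`; the dual of `T`
is `B`.
-/

namespace TiltingQuiver

/-! ### Short exact sequences and vanishing of Ext -/

section ExtVanishing

variable {R : Type u} [Ring R]
variable {X Y Z M N T : Type u} [AddCommGroup X] [Module R X] [AddCommGroup Y] [Module R Y]
  [AddCommGroup Z] [Module R Z] [AddCommGroup M] [Module R M] [AddCommGroup N] [Module R N]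
  [AddCommGroup T] [Module R T]

/-- The sequence `0 → X → Y → Z → 0` of modules is exact. -/
structure ShortExact (f : X →ₗ[R] Y) (g : Y →ₗ[R] Z) : Prop where
  inj : Function.Injective f
  exact : Function.Exact f g
  surj : Function.Surjective g

theorem shortExact_ker_subtype {g : Y →ₗ[R] Z} (hg : Function.Surjective g) :
    ShortExact (LinearMap.ker g).subtype g where
  inj := Subtype.val_injective
  exact := fun y => by simp
  surj := hg

/-- The short exact sequence, as a short complex in the category of modules. -/
abbrev ShortExact.complex {f : X →ₗ[R] Y} {g : Y →ₗ[R] Z} (h : ShortExact f g) :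
    ShortComplex (ModuleCat.{u} R) :=
  ModuleCat.shortComplexOfCompEqZero f g h.exact.linearMap_comp_eq_zero

theorem ShortExact.complex_shortExact {f : X →ₗ[R] Y} {g : Y →ₗ[R] Z} (h : ShortExact f g) :
    h.complex.ShortExact :=
  ModuleCat.shortComplex_shortExact _ h.exact h.inj h.surj

variable (R M N) in
/-- `Ext^i(M, N) = 0`. -/
def ExtZero (i : ℕ) : Prop :=
  Subsingleton (Abelian.Ext.{u} (ModuleCat.of R M) (ModuleCat.of R N) i)

variable (R M N) in
/-- `Ext^i(M, N) = 0` for all `i ≥ 1`. -/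
def ExtOrthogonal : Prop := ∀ i : ℕ, 1 ≤ i → ExtZero R M N i

variable (R M) in
/-- The module `M` has finite projective dimension, expressed as a uniform vanishing of `Ext`. -/
def FinProjDim : Prop :=
  ∃ n : ℕ, ∀ (N : Type u) [AddCommGroup N] [Module R N] (i : ℕ), n < i → ExtZero R M N i

theorem extZero_iff {i : ℕ} : ExtZero R M N i ↔
    ∀ e : Abelian.Ext.{u} (ModuleCat.of R M) (ModuleCat.of R N) i, e = 0 :=
  ⟨fun h e => h.elim e 0, fun h => ⟨fun a b => by rw [h a, h b]⟩⟩

namespace ShortExact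

variable {f : X →ₗ[R] Y} {g : Y →ₗ[R] Z} {i : ℕ}

theorem extZero_left_fst (h : ShortExact f g) (hY : ExtZero R Y N i) (hZ : ExtZero R Z N (i + 1)) :
    ExtZero R X N i := by
  rw [extZero_iff]
  intro e
  obtain ⟨y, rfl⟩ := Abelian.Ext.contravariant_sequence_exact₁ h.complex_shortExact _ e
    (add_comm 1 i) (hZ.elim _ _)
  rw [extZero_iff.1 hY y, Abelian.Ext.comp_zero]

theorem extZero_left_trd (h : ShortExact f g) (hX : ExtZero R X N i)
    (hY : ExtZero R Y N (i + 1)) : ExtZero R Z N (i + 1) := by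
  rw [extZero_iff]
  intro e
  obtain ⟨y, rfl⟩ := Abelian.Ext.contravariant_sequence_exact₃ h.complex_shortExact _ e
    (hY.elim _ _) (add_comm 1 i)
  rw [extZero_iff.1 hX y, Abelian.Ext.comp_zero]

theorem extZero_right_trd (h : ShortExact f g) (hY : ExtZero R M Y i)
    (hX : ExtZero R M X (i + 1)) : ExtZero R M Z i := by
  rw [extZero_iff]
  intro e
  obtain ⟨y, rfl⟩ := Abelian.Ext.covariant_sequence_exact₃ _ h.complex_shortExact e
    rfl (hX.elim _ _)
  rw [extZero_iff.1 hY y, Abelian.Ext.zero_comp]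

theorem extZero_right_fst (h : ShortExact f g) (hZ : ExtZero R M Z i)
    (hY : ExtZero R M Y (i + 1)) : ExtZero R M X (i + 1) := by
  rw [extZero_iff]
  intro e
  obtain ⟨y, rfl⟩ := Abelian.Ext.covariant_sequence_exact₁ _ h.complex_shortExact e
    (hY.elim _ _) rfl
  rw [extZero_iff.1 hZ y, Abelian.Ext.zero_comp]

theorem exists_extend (h : ShortExact f g) (hZ : ExtZero R Z N 1) (a : X →ₗ[R] N) :
    ∃ b : Y →ₗ[R] N, b ∘ₗ f = a := by
  obtain ⟨y, hy⟩ := Abelian.Ext.contravariant_sequence_exact₁ h.complex_shortExact _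
    (Abelian.Ext.mk₀ (ModuleCat.ofHom a)) (add_comm 1 0) (hZ.elim _ _)
  obtain ⟨b, rfl⟩ := Abelian.Ext.homEquiv₀.symm.surjective y
  refine ⟨b.hom, ?_⟩
  rw [Abelian.Ext.homEquiv₀_symm_apply, Abelian.Ext.mk₀_comp_mk₀] at hy
  exact congrArg ModuleCat.Hom.hom (Abelian.Ext.homEquiv₀.symm.injective hy)

theorem exists_lift (h : ShortExact f g) (hX : ExtZero R M X 1) (a : M →ₗ[R] Z) :
    ∃ b : M →ₗ[R] Y, g ∘ₗ b = a := by
  obtain ⟨y, hy⟩ := Abelian.Ext.covariant_sequence_exact₃ _ h.complex_shortExact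
    (Abelian.Ext.mk₀ (ModuleCat.ofHom a)) rfl (hX.elim _ _)
  obtain ⟨b, rfl⟩ := Abelian.Ext.homEquiv₀.symm.surjective y
  refine ⟨b.hom, ?_⟩
  rw [Abelian.Ext.homEquiv₀_symm_apply, Abelian.Ext.mk₀_comp_mk₀] at hy
  exact congrArg ModuleCat.Hom.hom (Abelian.Ext.homEquiv₀.symm.injective hy)

theorem extZero_one_of_extend (h : ShortExact f g) (hY : ExtZero R Y N 1)
    (hext : ∀ a : X →ₗ[R] N, ∃ b : Y →ₗ[R] N, b ∘ₗ f = a) : ExtZero R Z N 1 := by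
  rw [extZero_iff]
  intro e
  obtain ⟨y, rfl⟩ := Abelian.Ext.contravariant_sequence_exact₃ h.complex_shortExact _ e
    (hY.elim _ _) (add_comm 1 0)
  obtain ⟨a, rfl⟩ := Abelian.Ext.homEquiv₀.symm.surjective y
  obtain ⟨b, hb⟩ := hext a.hom
  have : a = h.complex.f ≫ ModuleCat.ofHom b := by
    ext1
    exact hb.symm
  rw [this, Abelian.Ext.homEquiv₀_symm_apply, ← Abelian.Ext.mk₀_comp_mk₀,
    h.complex_shortExact.extClass_comp_assoc]

theorem extZero_one_of_lift (h : ShortExact f g) (hY : ExtZero R M Y 1)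
    (hlift : ∀ a : M →ₗ[R] Z, ∃ b : M →ₗ[R] Y, g ∘ₗ b = a) : ExtZero R M X 1 := by
  rw [extZero_iff]
  intro e
  obtain ⟨y, rfl⟩ := Abelian.Ext.covariant_sequence_exact₁ _ h.complex_shortExact e
    (hY.elim _ _) rfl
  obtain ⟨a, rfl⟩ := Abelian.Ext.homEquiv₀.symm.surjective y
  obtain ⟨b, hb⟩ := hlift a.hom
  have : a = ModuleCat.ofHom b ≫ h.complex.g := by
    ext1
    exact hb.symm
  rw [this, Abelian.Ext.homEquiv₀_symm_apply, ← Abelian.Ext.mk₀_comp_mk₀,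
    Abelian.Ext.comp_assoc_of_second_deg_zero, h.complex_shortExact.comp_extClass,
    Abelian.Ext.comp_zero]

theorem extOrthogonal_left_fst (h : ShortExact f g) (hY : ExtOrthogonal R Y N)
    (hZ : ExtOrthogonal R Z N) : ExtOrthogonal R X N :=
  fun i hi => h.extZero_left_fst (hY i hi) (hZ _ (by omega))

theorem extOrthogonal_left_trd (h : ShortExact f g) (hX : ExtOrthogonal R X N)
    (hY : ExtOrthogonal R Y N) (hext : ∀ a : X →ₗ[R] N, ∃ b : Y →ₗ[R] N, b ∘ₗ f = a) :
    ExtOrthogonal R Z N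
  | 1, _ => h.extZero_one_of_extend (hY 1 le_rfl) hext
  | i + 2, _ => h.extZero_left_trd (hX (i + 1) (by omega)) (hY _ (by omega))

theorem extOrthogonal_right_trd (h : ShortExact f g) (hX : ExtOrthogonal R M X)
    (hY : ExtOrthogonal R M Y) : ExtOrthogonal R M Z :=
  fun i hi => h.extZero_right_trd (hY i hi) (hX _ (by omega))

theorem extOrthogonal_right_fst (h : ShortExact f g) (hY : ExtOrthogonal R M Y)
    (hZ : ExtOrthogonal R M Z) (hlift : ∀ a : M →ₗ[R] Z, ∃ b : M →ₗ[R] Y, g ∘ₗ b = a) :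
    ExtOrthogonal R M X
  | 1, _ => h.extZero_one_of_lift (hY 1 le_rfl) hlift
  | i + 2, _ => h.extZero_right_fst (hZ (i + 1) (by omega)) (hY _ (by omega))

theorem finProjDim_fst (h : ShortExact f g) (hY : FinProjDim R Y) (hZ : FinProjDim R Z) :
    FinProjDim R X := by
  obtain ⟨m, hm⟩ := hY
  obtain ⟨n, hn⟩ := hZ
  exact ⟨max m n, fun N _ _ i hi => h.extZero_left_fst (hm N i (by omega)) (hn N _ (by omega))⟩

theorem finProjDim_trd (h : ShortExact f g) (hX : FinProjDim R X) (hY : FinProjDim R Y) :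
    FinProjDim R Z := by
  obtain ⟨m, hm⟩ := hX
  obtain ⟨n, hn⟩ := hY
  refine ⟨max m n + 1, fun N _ _ i hi => ?_⟩
  obtain ⟨j, rfl⟩ : ∃ j, i = j + 1 := ⟨i - 1, by omega⟩
  exact h.extZero_left_trd (hm N j (by omega)) (hn N _ (by omega))

end ShortExact

/-- Membership in `add T`, with the maps to and from the power of `T` split into components. -/
theorem inAdd_iff : InAdd R M T ↔ ∃ (m : ℕ) (i : Fin m → (M →ₗ[R] T)) (p : Fin m → (T →ₗ[R] M)),
    ∀ x, ∑ j, p j (i j x) = x := by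
  constructor
  · rintro ⟨m, i, p, h⟩
    refine ⟨m, fun j => LinearMap.proj j ∘ₗ i, fun j => p ∘ₗ LinearMap.single R (fun _ => T) j,
      fun x => ?_⟩
    conv_rhs => rw [← LinearMap.id_apply (R := R) x, ← h]
    simp only [LinearMap.comp_apply, ← map_sum, LinearMap.proj_apply, LinearMap.single_apply]
    rw [Finset.univ_sum_single]
  · rintro ⟨m, i, p, h⟩
    refine ⟨m, LinearMap.pi i, ∑ j, p j ∘ₗ LinearMap.proj j, ?_⟩
    ext x
    simpa using h x

theorem inAdd_self : InAdd R T T :=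
  inAdd_iff.2 ⟨1, fun _ => LinearMap.id, fun _ => LinearMap.id, fun x => by simp⟩

theorem inAdd_pow (n : ℕ) : InAdd R (Fin n → T) T :=
  ⟨n, LinearMap.id, LinearMap.id, rfl⟩

theorem InAdd.of_retract (h : InAdd R N T) (i : M →ₗ[R] N) (p : N →ₗ[R] M)
    (hpi : ∀ x, p (i x) = x) : InAdd R M T := by
  obtain ⟨m, i', p', h'⟩ := h
  refine ⟨m, i' ∘ₗ i, p ∘ₗ p', ?_⟩
  ext x
  have : p' (i' (i x)) = i x := LinearMap.congr_fun h' (i x)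
  simp [this, hpi]

theorem InAdd.congr_right (h : InAdd R M T) (e : T ≃ₗ[R] N) : InAdd R M N := by
  obtain ⟨m, i, p, h⟩ := inAdd_iff.1 h
  exact inAdd_iff.2 ⟨m, fun j => e.toLinearMap ∘ₗ i j, fun j => p j ∘ₗ e.symm.toLinearMap,
    fun x => by simpa using h x⟩

/-- An element of `Ext` is the sum of its components through the copies of `T`. -/
theorem ExtZero.of_inAdd_left {i : ℕ} (hM : InAdd R M T) (h : ExtZero R T N i) :
    ExtZero R M N i := by
  obtain ⟨m, a, p, hap⟩ := inAdd_iff.1 hM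
  rw [extZero_iff]
  intro e
  have hid : (𝟙 (ModuleCat.of R M)) = ∑ j, ModuleCat.ofHom (a j) ≫ ModuleCat.ofHom (p j) := by
    ext x
    simpa using (hap x).symm
  rw [← e.mk₀_id_comp, hid, Abelian.Ext.mk₀_sum, Abelian.Ext.sum_comp]
  refine Finset.sum_eq_zero fun j _ => ?_
  rw [← Abelian.Ext.mk₀_comp_mk₀, Abelian.Ext.comp_assoc_of_second_deg_zero,
    extZero_iff.1 h ((Abelian.Ext.mk₀ _).comp e _), Abelian.Ext.comp_zero]

theorem ExtZero.of_inAdd_right {i : ℕ} (hM : InAdd R M T) (h : ExtZero R N T i) :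
    ExtZero R N M i := by
  obtain ⟨m, a, p, hap⟩ := inAdd_iff.1 hM
  rw [extZero_iff]
  intro e
  have hid : (𝟙 (ModuleCat.of R M)) = ∑ j, ModuleCat.ofHom (a j) ≫ ModuleCat.ofHom (p j) := by
    ext x
    simpa using (hap x).symm
  rw [← e.comp_mk₀_id, hid, Abelian.Ext.mk₀_sum, Abelian.Ext.comp_sum]
  refine Finset.sum_eq_zero fun j _ => ?_
  rw [← Abelian.Ext.mk₀_comp_mk₀, ← Abelian.Ext.comp_assoc_of_third_deg_zero,
    extZero_iff.1 h (e.comp (Abelian.Ext.mk₀ _) _), Abelian.Ext.zero_comp]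

theorem ExtOrthogonal.of_inAdd_left (hM : InAdd R M T) (h : ExtOrthogonal R T N) :
    ExtOrthogonal R M N := fun i hi => (h i hi).of_inAdd_left hM

theorem ExtOrthogonal.of_inAdd_right (hM : InAdd R M T) (h : ExtOrthogonal R N T) :
    ExtOrthogonal R N M := fun i hi => (h i hi).of_inAdd_right hM

theorem FinProjDim.of_inAdd (hM : InAdd R M T) (h : FinProjDim R T) : FinProjDim R M :=
  h.imp fun _ hn N _ _ i hi => (hn N i hi).of_inAdd_left hM

theorem inAdd_of_equiv (e : M ≃ₗ[R] T) : InAdd R M T :=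
  inAdd_self.of_retract e.toLinearMap e.symm.toLinearMap fun x => by simp

theorem extOrthogonal_of_projective [Module.Projective R M] : ExtOrthogonal R M N := by
  intro i hi
  have : Projective (ModuleCat.of R M) :=
    (IsProjective.iff_projective (R := R) M).1 inferInstance
  exact HasProjectiveDimensionLT.subsingleton (ModuleCat.of R M) 1 i hi _

theorem finProjDim_of_projective [Module.Projective R M] : FinProjDim R M :=
  ⟨0, fun _ _ _ i hi => extOrthogonal_of_projective i hi⟩

theorem finProjDim_iff :
    FinProjDim R M ↔ ∃ n : ℕ, HasProjectiveDimensionLE (ModuleCat.of R M) n := by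
  refine exists_congr fun n => ⟨fun h => ?_, fun h N _ _ i hi => ?_⟩
  · exact (hasProjectiveDimensionLT_iff.{u} _ _).2 fun i hi Y => extZero_iff.1 (h Y i hi)
  · exact HasProjectiveDimensionLT.subsingleton _ (n + 1) i hi _

theorem IsTilting.finProjDim (h : IsTilting R T) : FinProjDim R T :=
  finProjDim_iff.2 h.finite_projectiveDimension

end ExtVanishing

/-! ### Rings with finite approximations -/

/-- A left noetherian ring `R` over which every finitely generated module `Y` has, for
every finitely generated `X`, a right `add X`-approximation `X^n → Y`. Finite dimensional algebras
have this property; it is all that the tilting theory below uses of them. -/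
structure HasFiniteApproximations (R : Type u) [Ring R] : Prop where
  noetherian : IsNoetherianRing R
  approx : ∀ (X Y : Type u) [AddCommGroup X] [Module R X] [AddCommGroup Y] [Module R Y]
    [Module.Finite R X] [Module.Finite R Y], ∃ (n : ℕ) (φ : (Fin n → X) →ₗ[R] Y),
      ∀ f : X →ₗ[R] Y, ∃ g : X →ₗ[R] (Fin n → X), φ ∘ₗ g = f

theorem finite_linearMap (k : Type v) [Field k] {R : Type u} [Ring R] [Algebra k R]
    (X Y : Type u) [AddCommGroup X] [Module R X] [AddCommGroup Y] [Module R Y] [Module k X]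
    [Module k Y] [IsScalarTower k R X] [IsScalarTower k R Y] [SMulCommClass R k Y]
    [FiniteDimensional k X] [FiniteDimensional k Y] : FiniteDimensional k (X →ₗ[R] Y) :=
  FiniteDimensional.of_injective (LinearMap.restrictScalarsₗ k R X Y k)
    (LinearMap.restrictScalars_injective k)

theorem hasFiniteApproximations_of_finiteDimensional (k : Type v) [Field k] (R : Type u) [Ring R]
    [Algebra k R] [FiniteDimensional k R] : HasFiniteApproximations R where
  noetherian := isNoetherian_of_tower k inferInstance
  approx X Y _ _ _ _ _ _ := by
    let : Module k X := Module.compHom X (algebraMap k R)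
    let : Module k Y := Module.compHom Y (algebraMap k R)
    have : IsScalarTower k R X := ⟨fun a b x => by
      rw [Algebra.smul_def, mul_smul]; rfl⟩
    have : IsScalarTower k R Y := ⟨fun a b x => by
      rw [Algebra.smul_def, mul_smul]; rfl⟩
    have : SMulCommClass R k X := IsScalarTower.to_smulCommClass'
    have : SMulCommClass R k Y := IsScalarTower.to_smulCommClass'
    have : FiniteDimensional k X := Module.Finite.trans R X
    have : FiniteDimensional k Y := Module.Finite.trans R Y
    have := finite_linearMap k (R := R) X Y
    let b := Module.finBasis k (X →ₗ[R] Y)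
    refine ⟨_, ∑ j, b j ∘ₗ LinearMap.proj j, fun f =>
      ⟨LinearMap.pi fun j => b.repr f j • LinearMap.id, ?_⟩⟩
    ext x
    conv_rhs => rw [← b.sum_repr f]
    simp only [LinearMap.comp_apply, LinearMap.sum_apply, LinearMap.proj_apply, LinearMap.pi_apply,
      LinearMap.smul_apply, LinearMap.id_apply]
    refine Finset.sum_congr rfl fun j _ => ?_
    -- the action of `k` is through `R`
    exact (b j).map_smul (algebraMap k R (b.repr f j)) x

theorem hasFiniteApproximations_end (k : Type v) [Field k] {R : Type u} [Ring R]
    [Algebra k R] [FiniteDimensional k R] (T : Type u) [AddCommGroup T] [Module R T]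
    [Module.Finite R T] :
    HasFiniteApproximations (Module.End R T) ∧ Module.Finite (Module.End R T) T := by
  let : Module k T := Module.compHom T (algebraMap k R)
  have : IsScalarTower k R T := ⟨fun a b x => by
    rw [Algebra.smul_def, mul_smul]; rfl⟩
  have : SMulCommClass R k T := IsScalarTower.to_smulCommClass'
  have : FiniteDimensional k T := Module.Finite.trans R T
  have : FiniteDimensional k (Module.End R T) := finite_linearMap k (R := R) T T
  exact ⟨hasFiniteApproximations_of_finiteDimensional k _,
    Module.Finite.of_restrictScalars_finite k _ _⟩

/-! ### Finite coresolutions -/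

section Tilting

variable {R : Type u} [Ring R]
variable {X Y T : Type u} [AddCommGroup X] [Module R X] [AddCommGroup Y] [Module R Y]
  [AddCommGroup T] [Module R T]

variable (R T) in
/-- `M` has a finite coresolution by modules in `add T`, built up one short exact sequence at a
time. -/
inductive AddCoresolved : (M : Type u) → [AddCommGroup M] → [Module R M] → Prop
  | zero (M : Type u) [AddCommGroup M] [Module R M] (h : Subsingleton M) : AddCoresolved M
  | step (M N C : Type u) [AddCommGroup M] [Module R M] [AddCommGroup N] [Module R N]
      [AddCommGroup C] [Module R C] (f : M →ₗ[R] N) (g : N →ₗ[R] C) (h : ShortExact f g)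
      (hN : InAdd R N T) (hC : AddCoresolved C) : AddCoresolved M

theorem inAdd_of_subsingleton [Subsingleton X] : InAdd R X T :=
  inAdd_iff.2 ⟨0, 0, 0, fun _ => Subsingleton.elim _ _⟩

theorem InAdd.addCoresolved (h : InAdd R X T) : AddCoresolved R T X :=
  .step X X PUnit LinearMap.id 0
    ⟨Function.injective_id, fun x => by simp, Function.surjective_to_subsingleton _⟩ h
    (.zero _ inferInstance)

theorem addCoresolved_of_exact (r : ℕ) : ∀ (M : Type u) [AddCommGroup M] [Module R M]
    (C : ℕ → ModuleCat.{u} R) (ι : M →ₗ[R] C 0) (d : ∀ i, C i →ₗ[R] C (i + 1)),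
    Function.Injective ι → Function.Exact ι (d 0) → (∀ i, Function.Exact (d i) (d (i + 1))) →
    (∀ i, InAdd R (C i) T) → (∀ i, r ≤ i → Subsingleton (C i)) → AddCoresolved R T M := by
  induction r with
  | zero =>
    intro M _ _ C ι d hι _ _ _ hC
    have := hC 0 le_rfl
    exact .zero M hι.subsingleton
  | succ r ih =>
    intro M _ _ C ι d hι hιd hd hadd hC
    refine .step M (C 0) (LinearMap.range (d 0)) ι (d 0).rangeRestrict
      ⟨hι, fun y => ?_, LinearMap.surjective_rangeRestrict _⟩ (hadd 0)
      (ih _ (fun i => C (i + 1)) (LinearMap.range (d 0)).subtype (fun i => d (i + 1))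
        Subtype.val_injective (fun y => ?_) (fun i => hd (i + 1)) (fun i => hadd (i + 1))
        fun i hi => hC (i + 1) (by omega))
    · rw [← hιd y, ← Subtype.coe_inj]
      rfl
    · rw [hd 0 y]
      simp

/-- The sequence of modules `N, C 0, C 1, …`. -/
def consModule (N : ModuleCat.{u} R) (C : ℕ → ModuleCat.{u} R) : ℕ → ModuleCat.{u} R
  | 0 => N
  | i + 1 => C i

/-- The sequence of maps `N → C 0 → C 1 → ⋯`. -/
def consMap {N : ModuleCat.{u} R} {C : ℕ → ModuleCat.{u} R} (j : N →ₗ[R] C 0)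
    (d : ∀ i, C i →ₗ[R] C (i + 1)) : ∀ i, consModule N C i →ₗ[R] consModule N C (i + 1)
  | 0 => j
  | i + 1 => d i

theorem AddCoresolved.exists_exact {M : Type u} [AddCommGroup M] [Module R M]
    (h : AddCoresolved R T M) :
    ∃ (C : ℕ → ModuleCat.{u} R) (ι : M →ₗ[R] C 0) (d : ∀ i, C i →ₗ[R] C (i + 1)) (r : ℕ),
      Function.Injective ι ∧ Function.Exact ι (d 0) ∧ (∀ i, Function.Exact (d i) (d (i + 1))) ∧
      (∀ i, InAdd R (C i) T) ∧ ∀ i, r < i → Subsingleton (C i) := by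
  induction h with
  | zero M h =>
    refine ⟨fun _ => ModuleCat.of R PUnit, 0, fun _ => 0, 0,
      Function.injective_of_subsingleton _, fun y => ?_, fun i y => ?_,
      fun i => inAdd_of_subsingleton, fun i _ => inferInstance⟩
    · exact ⟨fun _ => ⟨0, Subsingleton.elim (α := PUnit) _ _⟩, fun _ => rfl⟩
    · exact ⟨fun _ => ⟨0, Subsingleton.elim (α := PUnit) _ _⟩, fun _ => rfl⟩
  | step M N D f g hfg hN _ ih =>
    obtain ⟨C, ι, d, r, hι, hιd, hd, hadd, hC⟩ := ih
    refine ⟨consModule (ModuleCat.of R N) C, f, consMap (ι ∘ₗ g) d, r + 1,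
      hfg.inj, fun y => ?_, fun i y => ?_, fun i => ?_, fun i hi => ?_⟩
    · refine Iff.trans ?_ (hfg.exact y)
      exact (map_eq_zero_iff ι hι : ι (g y) = 0 ↔ g y = 0)
    · match i, y with
      | 0, y =>
        refine (hιd y).trans ?_
        exact (congrArg (y ∈ ·) (hfg.surj.range_comp ι)).symm.to_iff
      | i + 1, y => exact hd i y
    · match i with
      | 0 => exact hN
      | i + 1 => exact hadd i
    · match i with
      | i + 1 => exact hC i (by omega)

theorem hasAddCoresolution_iff : HasAddCoresolution R T ↔ AddCoresolved R T R := by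
  constructor
  · rintro ⟨C, ι, d, r, h1, h2, h3, h4, h5⟩
    exact addCoresolved_of_exact (r + 1) R C ι d h1 h2 h3 h4 fun i hi => h5 i hi
  · exact AddCoresolved.exists_exact

theorem AddCoresolved.congr_left {M : Type u} [AddCommGroup M] [Module R M]
    (h : AddCoresolved R T M) (e : X ≃ₗ[R] M) : AddCoresolved R T X := by
  cases h with
  | zero _ h => exact .zero X e.toEquiv.subsingleton
  | step _ N C f g h hN hC =>
    refine .step X N C (f ∘ₗ e.toLinearMap) g
      ⟨h.inj.comp e.injective, fun y => ?_, h.surj⟩ hN hC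
    rw [h.exact y]
    exact (congrArg (y ∈ ·) (e.surjective.range_comp f)).symm.to_iff

theorem AddCoresolved.congr_right {M : Type u} [AddCommGroup M] [Module R M]
    (h : AddCoresolved R T M) (e : T ≃ₗ[R] X) : AddCoresolved R X M := by
  induction h with
  | zero M h => exact .zero M h
  | step M N C f g h hN _ ih => exact .step M N C f g h (hN.congr_right e) ih

theorem AddCoresolved.extOrthogonal {M : Type u} [AddCommGroup M] [Module R M]
    (h : AddCoresolved R T M) (hT : ExtOrthogonal R T Y) : ExtOrthogonal R M Y := by
  induction h with
  | zero M h => exact hT.of_inAdd_left inAdd_of_subsingleton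
  | step M N C f g h hN _ ih => exact h.extOrthogonal_left_fst (hT.of_inAdd_left hN) ih

/-! ### Tilting modules and their right perpendicular categories -/

theorem IsTilting.extOrthogonal (h : IsTilting R T) : ExtOrthogonal R T T := h.selforthogonal

theorem IsTilting.congr (h : IsTilting R T) (e : T ≃ₗ[R] X) : IsTilting R X where
  finite := have := h.finite; Module.Finite.equiv e
  finite_projectiveDimension := finProjDim_iff.1 (h.finProjDim.of_inAdd (inAdd_of_equiv e.symm))
  selforthogonal := (h.extOrthogonal.of_inAdd_left (inAdd_of_equiv e.symm)).of_inAdd_right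
    (inAdd_of_equiv e.symm)
  coresolution := hasAddCoresolution_iff.2 ((hasAddCoresolution_iff.1 h.coresolution).congr_right e)

variable (R) in
theorem isTilting_self : IsTilting R R where
  finite := inferInstance
  finite_projectiveDimension := finProjDim_iff.1 finProjDim_of_projective
  selforthogonal := extOrthogonal_of_projective
  coresolution := hasAddCoresolution_iff.2 inAdd_self.addCoresolved

/-- A module in the right perpendicular category of a tilting module `X` is generated by `X`, and
the kernel of an approximation stays in the perpendicular category. -/
theorem IsTilting.exists_shortExact (hR : HasFiniteApproximations R) (hX : IsTilting R X)
    [Module.Finite R Y] (hY : ExtOrthogonal R X Y) :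
    ∃ (n : ℕ) (φ : (Fin n → X) →ₗ[R] Y), Function.Surjective φ ∧
      Module.Finite R (LinearMap.ker φ) ∧ ExtOrthogonal R X (LinearMap.ker φ) := by
  have := hX.finite
  have := hR.noetherian
  obtain ⟨n, φ, hφ⟩ := hR.approx X Y
  have hsurj : Function.Surjective φ := by
    intro y
    cases hasAddCoresolution_iff.1 hX.coresolution with
    | zero _ h =>
      refine ⟨0, ?_⟩
      rw [map_zero, ← one_smul R y, Subsingleton.elim (1 : R) 0, zero_smul]
    | step _ N C f g h hN hC =>
      -- The map `R → Y` with value `y` extends to `N`, because `Ext^1(C, Y) = 0`.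
      obtain ⟨b, hb⟩ := h.exists_extend (hC.extOrthogonal hY 1 le_rfl)
        (LinearMap.toSpanSingleton R Y y)
      obtain ⟨m, i, p, hip⟩ := inAdd_iff.1 hN
      have hy : y = ∑ j, b (p j (i j (f 1))) := by
        rw [← map_sum, hip]
        simpa using (LinearMap.congr_fun hb 1).symm
      choose c hc using fun j => hφ (b ∘ₗ p j)
      refine ⟨∑ j, c j (i j (f 1)), ?_⟩
      rw [map_sum, hy]
      exact Finset.sum_congr rfl fun j _ => LinearMap.congr_fun (hc j) _
  refine ⟨n, φ, hsurj, inferInstance, (shortExact_ker_subtype hsurj).extOrthogonal_right_fst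
    (hX.extOrthogonal.of_inAdd_right (inAdd_pow n)) hY fun a => hφ a⟩

/-- If `X` lies in the right perpendicular category of `T`, so does everything in the right
perpendicular category of `X`: the modules there have resolutions by powers of `X`, and the
projective dimension of `T` is finite. -/
theorem IsTilting.extOrthogonal_of_perp (hR : HasFiniteApproximations R) (hX : IsTilting R X)
    (hT : FinProjDim R T) (hTX : ExtOrthogonal R T X) [Module.Finite R Y]
    (hY : ExtOrthogonal R X Y) : ExtOrthogonal R T Y := by
  obtain ⟨n, hn⟩ := hT
  have key : ∀ (d : ℕ) (Y : Type u) [AddCommGroup Y] [Module R Y] [Module.Finite R Y],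
      ExtOrthogonal R X Y → ∀ i, 1 ≤ i → n < i + d → ExtZero R T Y i := by
    intro d
    induction d with
    | zero => exact fun Y _ _ _ _ i _ h => hn Y i h
    | succ d ih =>
      intro Y _ _ _ hY i hi h
      obtain ⟨m, φ, hφ, hfin, hker⟩ := hX.exists_shortExact hR hY
      exact (shortExact_ker_subtype hφ).extZero_right_trd
        (hTX.of_inAdd_right (inAdd_pow m) i hi) (ih _ hker _ (by omega) (by omega))
  exact fun i hi => key n Y hY i hi (by omega)

theorem TiltingClass.mk_le_mk_iff (hR : HasFiniteApproximations R) (hX : IsBasicTilting R X)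
    (hY : IsBasicTilting R Y) :
    TiltingClass.mk R X hX ≤ TiltingClass.mk R Y hY ↔ ExtOrthogonal R Y X := by
  constructor
  · intro h
    exact (h (show ModuleCat.of R X ∈ TiltingQuiver.perp (ModuleCat.of R X) from
      ⟨hX.isTilting.finite, hX.isTilting.extOrthogonal⟩)).2
  · rintro h M ⟨hM, hM'⟩
    exact ⟨hM, hX.isTilting.extOrthogonal_of_perp hR hY.isTilting.finProjDim h hM'⟩

theorem TiltingClass.mk_eq_mk_iff (hX : IsBasicTilting R X) (hY : IsBasicTilting R Y) :
    TiltingClass.mk R X hX = TiltingClass.mk R Y hY ↔ Nonempty (X ≃ₗ[R] Y) :=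
  Quotient.eq (r := basicTiltingSetoid R)

end Tilting

/-! ### The dual with respect to a bimodule -/

section Duality

variable {A B : Type u} [Ring A] [Ring B] {T : Type u} [AddCommGroup T] [Module A T] [Module B T]
  [SMulCommClass A B T]
variable {X Y Z : Type u} [AddCommGroup X] [Module A X] [AddCommGroup Y] [Module A Y]
  [AddCommGroup Z] [Module A Z]

variable (B T) in
/-- The functor `Hom_A(-, T)` to `B`-modules, on morphisms. -/
def dualMap (f : X →ₗ[A] Y) : (Y →ₗ[A] T) →ₗ[B] (X →ₗ[A] T) where
  toFun h := h ∘ₗ f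
  map_add' _ _ := rfl
  map_smul' _ _ := rfl

@[simp] theorem dualMap_apply (f : X →ₗ[A] Y) (h : Y →ₗ[A] T) (x : X) :
    dualMap B T f h x = h (f x) := rfl

variable (B) in
theorem ShortExact.dual {f : X →ₗ[A] Y} {g : Y →ₗ[A] Z} (h : ShortExact f g)
    (hext : ∀ a : X →ₗ[A] T, ∃ b : Y →ₗ[A] T, b ∘ₗ f = a) :
    ShortExact (dualMap B T g) (dualMap B T f) where
  inj a b hab := by
    ext z
    obtain ⟨y, rfl⟩ := h.surj z
    exact LinearMap.congr_fun hab y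
  exact b := by
    constructor
    · intro hb
      have hker : LinearMap.range f ≤ LinearMap.ker b := by
        rintro _ ⟨x, rfl⟩
        exact LinearMap.congr_fun hb x
      refine ⟨(LinearMap.range f).liftQ b hker ∘ₗ
        (h.exact.linearEquivOfSurjective h.surj).symm.toLinearMap, ?_⟩
      ext y
      have : (h.exact.linearEquivOfSurjective h.surj).symm (g y) =
          (LinearMap.range f).mkQ y := by
        rw [LinearEquiv.symm_apply_eq]
        rfl
      simp [this]
    · rintro ⟨c, rfl⟩
      ext x
      simp [h.exact.apply_apply_eq_zero]
  surj := hext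

variable (B T) in
/-- The dual of a linear equivalence. -/
def dualEquiv (e : X ≃ₗ[A] Y) : (Y →ₗ[A] T) ≃ₗ[B] (X →ₗ[A] T) :=
  LinearEquiv.ofLinearMap (dualMap B T e.toLinearMap) (dualMap B T e.symm.toLinearMap)
    (by ext; simp) (by ext; simp)

theorem InAdd.dual (h : InAdd A X Y) : InAdd B (X →ₗ[A] T) (Y →ₗ[A] T) := by
  obtain ⟨m, i, p, hip⟩ := inAdd_iff.1 h
  refine inAdd_iff.2 ⟨m, fun j => dualMap B T (p j), fun j => dualMap B T (i j), fun f => ?_⟩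
  ext x
  simp only [LinearMap.sum_apply, dualMap_apply]
  rw [← map_sum, hip]

variable (A B T) in
/-- The dual of the regular `A`-module is `T`. -/
noncomputable def regularDual : (A →ₗ[A] T) ≃ₗ[B] T := LinearMap.ringLmapEquivSelf A B T

variable (A T X) in
/-- The finitely generated modules of finite projective dimension without higher extensions
by `T`. -/
structure IsPerpendicular : Prop where
  finite : Module.Finite A X
  finProjDim : FinProjDim A X
  extOrthogonal : ExtOrthogonal A X T

variable [SMulCommClass B A T]

variable (A B T X) in
/-- The evaluation map from a module to its double dual. -/
def evalMap : X →ₗ[A] ((X →ₗ[A] T) →ₗ[B] T) where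
  toFun x :=
    { toFun := fun f => f x
      map_add' := fun _ _ => rfl
      map_smul' := fun _ _ => rfl }
  map_add' x y := by ext f; exact f.map_add x y
  map_smul' a x := by ext f; exact f.map_smul a x

@[simp] theorem evalMap_apply (x : X) (f : X →ₗ[A] T) : evalMap A B T X x f = f x := rfl

variable (A B T X) in
/-- The modules `X` for which `Hom_A(-, T)` is a good duality: there are no higher extensions of
`X` by `T` nor of the dual of `X` by `T`, evaluation is an isomorphism to the double dual, and the
dual has finite projective dimension. -/
structure IsDualizable : Prop where
  extOrthogonal : ExtOrthogonal A X T
  bijective : Function.Bijective (evalMap A B T X)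
  dual_extOrthogonal : ExtOrthogonal B (X →ₗ[A] T) T
  dual_finProjDim : FinProjDim B (X →ₗ[A] T)

theorem bijective_evalMap_of_inAdd (hX : InAdd A X Y) (h : Function.Bijective (evalMap A B T Y)) :
    Function.Bijective (evalMap A B T X) := by
  obtain ⟨m, i, p, hip⟩ := inAdd_iff.1 hX
  constructor
  · rw [injective_iff_map_eq_zero]
    intro x hx
    have : ∀ j, i j x = 0 := fun j => h.1 <| by
      ext f
      simpa using LinearMap.congr_fun hx (f ∘ₗ i j)
    rw [← hip x]
    simp [this]
  · intro ξ
    choose y hy using fun j => h.2 (ξ ∘ₗ dualMap B T (i j))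
    refine ⟨∑ j, p j (y j), ?_⟩
    ext f
    have key : ∀ j, f (p j (y j)) = ξ (f ∘ₗ p j ∘ₗ i j) := fun j =>
      LinearMap.congr_fun (hy j) (f ∘ₗ p j)
    rw [evalMap_apply, map_sum, Finset.sum_congr rfl fun j _ => key j, ← map_sum]
    congr 1
    ext x
    simp only [LinearMap.sum_apply, LinearMap.comp_apply]
    rw [← map_sum, hip]

namespace IsDualizable

theorem of_inAdd (hX : InAdd A X Y) (h : IsDualizable A B T Y) : IsDualizable A B T X where
  extOrthogonal := h.extOrthogonal.of_inAdd_left hX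
  bijective := bijective_evalMap_of_inAdd hX h.bijective
  dual_extOrthogonal := h.dual_extOrthogonal.of_inAdd_left hX.dual
  dual_finProjDim := h.dual_finProjDim.of_inAdd hX.dual

/-- Dualizable modules are closed under kernels of epimorphisms. -/
theorem fst {f : X →ₗ[A] Y} {g : Y →ₗ[A] Z} (h : ShortExact f g) (hY : IsDualizable A B T Y)
    (hZ : IsDualizable A B T Z) : IsDualizable A B T X := by
  have hd := h.dual B (h.exists_extend (hZ.extOrthogonal 1 le_rfl))
  refine ⟨h.extOrthogonal_left_fst hY.extOrthogonal hZ.extOrthogonal, ⟨?_, fun ξ => ?_⟩,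
    hd.extOrthogonal_left_trd hZ.dual_extOrthogonal hY.dual_extOrthogonal fun a => ?_,
    hd.finProjDim_trd hZ.dual_finProjDim hY.dual_finProjDim⟩
  · rw [injective_iff_map_eq_zero]
    intro x hx
    refine h.inj (hY.bijective.1 ?_)
    ext b
    simpa using LinearMap.congr_fun hx (b ∘ₗ f)
  · obtain ⟨y, hy⟩ := hY.bijective.2 (ξ ∘ₗ dualMap B T f)
    have hgy : g y = 0 := hZ.bijective.1 <| by
      ext c
      have h1 : c (g y) = ξ (dualMap B T f (dualMap B T g c)) :=
        LinearMap.congr_fun hy (c ∘ₗ g)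
      rw [evalMap_apply, h1, hd.exact.apply_apply_eq_zero]
      simp
    obtain ⟨x, rfl⟩ := (h.exact y).1 hgy
    refine ⟨x, ?_⟩
    ext a
    obtain ⟨b, rfl⟩ := hd.surj a
    exact LinearMap.congr_fun hy b
  · obtain ⟨z, rfl⟩ := hZ.bijective.2 a
    obtain ⟨y, rfl⟩ := h.surj z
    exact ⟨evalMap A B T Y y, rfl⟩

/-- Dualizable modules are closed under cokernels of monomorphisms, as long as there are no higher
extensions by `T`. -/
theorem trd {f : X →ₗ[A] Y} {g : Y →ₗ[A] Z} (h : ShortExact f g) (hX : IsDualizable A B T X)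
    (hY : IsDualizable A B T Y) (hZ : ExtOrthogonal A Z T) : IsDualizable A B T Z := by
  have hd := h.dual B (h.exists_extend (hZ 1 le_rfl))
  refine ⟨hZ, ⟨?_, fun ζ => ?_⟩,
    hd.extOrthogonal_left_fst hY.dual_extOrthogonal hX.dual_extOrthogonal,
    hd.finProjDim_fst hY.dual_finProjDim hX.dual_finProjDim⟩
  · rw [injective_iff_map_eq_zero]
    intro z hz
    obtain ⟨y, rfl⟩ := h.surj z
    choose s hs using hd.surj
    -- evaluation at `y` kills the dual of `Z`, hence it is a functional on the dual of `X`
    have hy : ∀ b b' : Y →ₗ[A] T, dualMap B T f b = dualMap B T f b' → b y = b' y := by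
      intro b b' hbb
      obtain ⟨c, hc⟩ := (hd.exact (b - b')).1 (by rw [map_sub, hbb, sub_self])
      have h1 : (b - b') y = 0 := by
        rw [← hc]
        exact LinearMap.congr_fun hz c
      rwa [LinearMap.sub_apply, sub_eq_zero] at h1
    let ξ : (X →ₗ[A] T) →ₗ[B] T :=
      { toFun := fun a => s a y
        map_add' := fun a a' => by
          rw [← LinearMap.add_apply]
          exact hy _ _ (by rw [map_add, hs, hs, hs])
        map_smul' := fun r a => by
          rw [RingHom.id_apply, ← LinearMap.smul_apply]
          exact hy _ _ (by rw [map_smul, hs, hs]) }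
    obtain ⟨x, hx⟩ := hX.bijective.2 ξ
    have hxy : f x = y := hY.bijective.1 <| by
      ext b
      have h1 : b (f x) = s (dualMap B T f b) y := LinearMap.congr_fun hx (b ∘ₗ f)
      rw [evalMap_apply, h1]
      exact hy _ _ (hs _)
    rw [← hxy, h.exact.apply_apply_eq_zero]
  · obtain ⟨η, rfl⟩ := hd.exists_extend (hX.dual_extOrthogonal 1 le_rfl) ζ
    obtain ⟨y, rfl⟩ := hY.bijective.2 η
    exact ⟨g y, rfl⟩

end IsDualizable

variable (A B T) in
/-- Every `A`-endomorphism of `T` is multiplication by a unique element of `B`. -/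
def IsBalanced : Prop :=
  Function.Bijective (DistribSMul.toLinearMap A T : B → T →ₗ[A] T)

/-- If `B` is the endomorphism ring of `T`, then the dual of `T` is the regular `B`-module. -/
noncomputable def IsBalanced.equiv (h : IsBalanced A B T) : B ≃ₗ[B] (T →ₗ[A] T) :=
  LinearEquiv.ofBijective
    { toFun := DistribSMul.toLinearMap A T
      map_add' := fun b c => by ext t; exact add_smul b c t
      map_smul' := fun b c => by ext t; exact mul_smul b c t } h

theorem isDualizable_of_isBalanced (h : IsBalanced A B T) (hT : ExtOrthogonal A T T) :
    IsDualizable A B T T where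
  extOrthogonal := hT
  bijective := by
    refine ⟨fun s t hst => LinearMap.congr_fun hst LinearMap.id,
      fun ξ => ⟨ξ LinearMap.id, ?_⟩⟩
    ext f
    obtain ⟨b, rfl⟩ := h.equiv.surjective f
    have : h.equiv b = b • LinearMap.id := by ext t; rfl
    rw [evalMap_apply, this, map_smul]
    rfl
  dual_extOrthogonal := extOrthogonal_of_projective.of_inAdd_left (inAdd_of_equiv h.equiv.symm)
  dual_finProjDim := finProjDim_of_projective.of_inAdd (inAdd_of_equiv h.equiv.symm)

theorem bijective_evalMap_regular_iff :
    Function.Bijective (evalMap A B T A) ↔ IsBalanced B A T := by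
  have h : (DistribSMul.toLinearMap B T : A → T →ₗ[B] T) =
      (fun ξ => ξ ∘ₗ (regularDual A B T).symm.toLinearMap) ∘ evalMap A B T A := by
    ext a t
    obtain ⟨f, rfl⟩ := (regularDual A B T).surjective t
    change a • f 1 = (regularDual A B T).symm (regularDual A B T f) a
    rw [LinearEquiv.symm_apply_apply, ← map_smul, smul_eq_mul, mul_one]
  have hb : Function.Bijective
      (fun ξ : (A →ₗ[A] T) →ₗ[B] T => ξ ∘ₗ (regularDual A B T).symm.toLinearMap) :=
    ⟨fun ξ η hξ => by
      ext f
      simpa using LinearMap.congr_fun hξ (regularDual A B T f),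
     fun η => ⟨η ∘ₗ (regularDual A B T).toLinearMap, by ext; simp⟩⟩
  rw [IsBalanced, h, hb.of_comp_iff']

theorem isDualizable_regular (h : IsBalanced B A T) (hT : ExtOrthogonal B T T)
    (hfin : FinProjDim B T) : IsDualizable A B T A where
  extOrthogonal := extOrthogonal_of_projective
  bijective := bijective_evalMap_regular_iff.2 h
  dual_extOrthogonal := hT.of_inAdd_left (inAdd_of_equiv (regularDual A B T))
  dual_finProjDim := hfin.of_inAdd (inAdd_of_equiv (regularDual A B T))

theorem AddCoresolved.isDualizable (h : AddCoresolved A T X) (hT : IsDualizable A B T T) :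
    IsDualizable A B T X := by
  induction h with
  | zero M h => exact hT.of_inAdd inAdd_of_subsingleton
  | step M N C f g h hN _ ih => exact .fst h (hT.of_inAdd hN) ih

theorem finite_dual (hB : IsNoetherianRing B) [Module.Finite B T] [Module.Finite A X] :
    Module.Finite B (X →ₗ[A] T) := by
  obtain ⟨n, s, hs⟩ := Module.Finite.exists_fin (R := A) (M := X)
  let ev : (X →ₗ[A] T) →ₗ[B] (Fin n → T) := LinearMap.pi fun i => evalMap A B T X (s i)
  refine Module.Finite.of_injective ev fun f g hfg => LinearMap.ext_on_range hs fun i => ?_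
  exact congrFun hfg i

/-! ### Tilting bimodules -/

variable (A B T) in
/-- A bimodule that is finitely generated, of finite projective dimension and without higher
self-extensions on both sides, such that either ring is the endomorphism ring of `T` over the
other. The definition is symmetric in `A` and `B`. -/
structure IsTiltingBimodule : Prop where
  approx_left : HasFiniteApproximations A
  approx_right : HasFiniteApproximations B
  finite_left : Module.Finite A T
  finite_right : Module.Finite B T
  finProjDim_left : FinProjDim A T
  finProjDim_right : FinProjDim B T
  extOrthogonal_left : ExtOrthogonal A T T
  extOrthogonal_right : ExtOrthogonal B T T
  balanced_left : IsBalanced A B T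
  balanced_right : IsBalanced B A T

/-- The coresolution of `A` by `add T` dualizes to a projective resolution of `T` over `B`, which
shows that `T` is tilting on the other side and that `A` is its endomorphism ring there. -/
theorem IsTilting.isTiltingBimodule (hA : HasFiniteApproximations A)
    (hB : HasFiniteApproximations B) (hT : IsTilting A T) (hfin : Module.Finite B T)
    (hbal : IsBalanced A B T) : IsTiltingBimodule A B T := by
  have h := (hasAddCoresolution_iff.1 hT.coresolution).isDualizable
    (isDualizable_of_isBalanced hbal hT.extOrthogonal)
  exact
    { approx_left := hA
      approx_right := hB
      finite_left := hT.finite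
      finite_right := hfin
      finProjDim_left := hT.finProjDim
      finProjDim_right := h.dual_finProjDim.of_inAdd (inAdd_of_equiv (regularDual A B T).symm)
      extOrthogonal_left := hT.extOrthogonal
      extOrthogonal_right :=
        h.dual_extOrthogonal.of_inAdd_left (inAdd_of_equiv (regularDual A B T).symm)
      balanced_left := hbal
      balanced_right := bijective_evalMap_regular_iff.1 h.bijective }

namespace IsTiltingBimodule

theorem symm (h : IsTiltingBimodule A B T) : IsTiltingBimodule B A T where
  approx_left := h.approx_right
  approx_right := h.approx_left
  finite_left := h.finite_right
  finite_right := h.finite_left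
  finProjDim_left := h.finProjDim_right
  finProjDim_right := h.finProjDim_left
  extOrthogonal_left := h.extOrthogonal_right
  extOrthogonal_right := h.extOrthogonal_left
  balanced_left := h.balanced_right
  balanced_right := h.balanced_left

theorem isDualizable (h : IsTiltingBimodule A B T) (hX : IsPerpendicular A T X) :
    IsDualizable A B T X := by
  have hreg := isDualizable_regular h.balanced_right h.extOrthogonal_right h.finProjDim_right
  have := h.approx_left.noetherian
  have key : ∀ (n : ℕ) (X : Type u) [AddCommGroup X] [Module A X] [Module.Finite A X],
      (∀ (N : Type u) [AddCommGroup N] [Module A N] (i : ℕ), n < i → ExtZero A X N i) →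
      ExtOrthogonal A X T → IsDualizable A B T X := by
    intro n
    induction n with
    | zero =>
      intro X _ _ _ hn hX
      obtain ⟨m, φ, hφ⟩ := Module.Finite.exists_fin' A X
      obtain ⟨s, hs⟩ := (shortExact_ker_subtype hφ).exists_lift (hn _ 1 one_pos) LinearMap.id
      exact hreg.of_inAdd ((inAdd_pow m).of_retract s φ fun x => LinearMap.congr_fun hs x)
    | succ n ih =>
      intro X _ _ _ hn hX
      obtain ⟨m, φ, hφ⟩ := Module.Finite.exists_fin' A X
      have hse := shortExact_ker_subtype hφ
      refine .trd hse (ih _ (fun N _ _ i hi => ?_) ?_) (hreg.of_inAdd (inAdd_pow m)) hX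
      · exact hse.extZero_left_fst (extOrthogonal_of_projective i (by omega))
          (hn N _ (by omega))
      · exact hse.extOrthogonal_left_fst extOrthogonal_of_projective hX
  obtain ⟨n, hn⟩ := hX.finProjDim
  have := hX.finite
  exact key n X hn hX.extOrthogonal

theorem isPerpendicular_dual (h : IsTiltingBimodule A B T) (hX : IsPerpendicular A T X) :
    IsPerpendicular B T (X →ₗ[A] T) := by
  have := hX.finite
  have := h.finite_right
  exact ⟨finite_dual h.approx_right.noetherian, (h.isDualizable hX).dual_finProjDim,
    (h.isDualizable hX).dual_extOrthogonal⟩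

/-- The evaluation isomorphism from a module to its double dual. -/
noncomputable def evalEquiv (h : IsTiltingBimodule A B T) (hX : IsPerpendicular A T X) :
    X ≃ₗ[A] ((X →ₗ[A] T) →ₗ[B] T) :=
  LinearEquiv.ofBijective (evalMap A B T X) (h.isDualizable hX).bijective

/-- Duality carries vanishing of extensions to vanishing of extensions. The proof shifts the
degree along a free cover of the dual of `Y`. -/
theorem extOrthogonal_dual (h : IsTiltingBimodule A B T)
    (hX : IsPerpendicular A T X) (hY : IsPerpendicular A T Y)
    (hXY : ExtOrthogonal A X Y) : ExtOrthogonal B (Y →ₗ[A] T) (X →ₗ[A] T) := by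
  have hB := h.approx_right.noetherian
  have key : ∀ (i : ℕ) (Y : Type u) [AddCommGroup Y] [Module A Y], IsPerpendicular A T Y →
      ExtOrthogonal A X Y → ExtZero B (Y →ₗ[A] T) (X →ₗ[A] T) (i + 1) := by
    intro i
    induction i with
    | zero =>
      intro Y _ _ hY hXY
      have hY' := h.isPerpendicular_dual hY
      have := hY'.finite
      obtain ⟨m, φ, hφ⟩ := Module.Finite.exists_fin' B (Y →ₗ[A] T)
      have hse := shortExact_ker_subtype hφ
      have hd := hse.dual A (hse.exists_extend (hY'.extOrthogonal 1 le_rfl))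
      refine hse.extZero_one_of_extend (extOrthogonal_of_projective 1 le_rfl) fun a => ?_
      -- A map to the dual of `X` is a map from `X` to a dual; lift it there and go back.
      let a' : X →ₗ[A] (LinearMap.ker φ →ₗ[B] T) := dualMap A T a ∘ₗ evalMap A B T X
      obtain ⟨c, hc⟩ := hd.exists_lift
        (hXY.of_inAdd_right (inAdd_of_equiv (h.evalEquiv hY).symm) 1 le_rfl) a'
      refine ⟨dualMap B T c ∘ₗ evalMap B A T (Fin m → B), ?_⟩
      ext q x
      exact LinearMap.congr_fun (LinearMap.congr_fun hc x) q
    | succ i ih =>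
      intro Y _ _ hY hXY
      have hY' := h.isPerpendicular_dual hY
      have := hY'.finite
      obtain ⟨m, φ, hφ⟩ := Module.Finite.exists_fin' B (Y →ₗ[A] T)
      have hse := shortExact_ker_subtype hφ
      have hd := hse.dual A (hse.exists_extend (hY'.extOrthogonal 1 le_rfl))
      have hK : IsPerpendicular B T (LinearMap.ker φ) :=
        ⟨inferInstance, hse.finProjDim_fst finProjDim_of_projective hY'.finProjDim,
          hse.extOrthogonal_left_fst extOrthogonal_of_projective hY'.extOrthogonal⟩
      refine hse.extZero_left_trd ?_ (extOrthogonal_of_projective _ (by omega))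
      refine (ih (LinearMap.ker φ →ₗ[B] T) (h.symm.isPerpendicular_dual hK) ?_).of_inAdd_left
        (inAdd_of_equiv (h.symm.evalEquiv hK))
      refine hd.extOrthogonal_right_trd
        (hXY.of_inAdd_right (inAdd_of_equiv (h.evalEquiv hY).symm)) ?_
      exact (hX.extOrthogonal.of_inAdd_right (inAdd_of_equiv (regularDual B A T))).of_inAdd_right
        (inAdd_pow m).dual
  rintro (_ | i) hi
  · omega
  · exact key i Y hY hXY

/-- If `X` is tilting, then `T` has a finite resolution by modules in `add X`, which dualizes to a
coresolution of `B`; the length is bounded by the projective dimension of `T`. -/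
theorem addCoresolved_dual (h : IsTiltingBimodule A B T) (hX : IsTilting A X)
    (hXT : ExtOrthogonal A X T) :
    AddCoresolved B (X →ₗ[A] T) B := by
  have := hX.finite
  have key : ∀ (d : ℕ) (Z : Type u) [AddCommGroup Z] [Module A Z] [Module.Finite A Z],
      ExtOrthogonal A X Z → ExtOrthogonal A Z T →
      (∀ (N : Type u) [AddCommGroup N] [Module A N], ExtOrthogonal A X N →
        ∀ i, d < i → ExtZero A Z N i) → AddCoresolved B (X →ₗ[A] T) (Z →ₗ[A] T) := by
    intro d
    induction d with
    | zero =>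
      intro Z _ _ _ hXZ hZT hZ
      obtain ⟨m, φ, hφ, _, hker⟩ := hX.exists_shortExact h.approx_left hXZ
      obtain ⟨s, hs⟩ := (shortExact_ker_subtype hφ).exists_lift (hZ _ hker 1 one_pos)
        LinearMap.id
      exact ((inAdd_pow m).of_retract s φ fun x => LinearMap.congr_fun hs x).dual.addCoresolved
    | succ d ih =>
      intro Z _ _ _ hXZ hZT hZ
      obtain ⟨m, φ, hφ, _, hker⟩ := hX.exists_shortExact h.approx_left hXZ
      have hse := shortExact_ker_subtype hφ
      refine .step _ _ _ _ _ (hse.dual B (hse.exists_extend (hZT 1 le_rfl))) (inAdd_pow m).dual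
        (ih _ hker (hse.extOrthogonal_left_fst (hXT.of_inAdd_left (inAdd_pow m)) hZT)
          fun N _ _ hN i hi => ?_)
      exact hse.extZero_left_fst (hN.of_inAdd_left (inAdd_pow m) i (by omega))
        (hZ N hN _ (by omega))
  obtain ⟨n, hn⟩ := h.finProjDim_left
  have := h.finite_left
  exact (key n T hXT h.extOrthogonal_left fun N _ _ _ => hn N).congr_left h.balanced_left.equiv

theorem isTilting_dual (h : IsTiltingBimodule A B T) (hX : IsTilting A X)
    (hXT : ExtOrthogonal A X T) :
    IsTilting B (X →ₗ[A] T) := by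
  have hX' : IsPerpendicular A T X := ⟨hX.finite, hX.finProjDim, hXT⟩
  have hd := h.isPerpendicular_dual hX'
  exact
    { finite := hd.finite
      finite_projectiveDimension := finProjDim_iff.1 hd.finProjDim
      selforthogonal := h.extOrthogonal_dual hX' hX' hX.extOrthogonal
      coresolution := hasAddCoresolution_iff.2 (h.addCoresolved_dual hX hXT) }

end IsTiltingBimodule

end Duality

/-! ### Basic modules and duality -/

section Basic

variable {R : Type u} [Ring R] {M N : Type u} [AddCommGroup M] [Module R M] [AddCommGroup N]
  [Module R N]

theorem isIndecomposable_iff : IsIndecomposable R M ↔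
    Nontrivial M ∧ ∀ e : M →ₗ[R] M, (∀ x, e (e x) = e x) → e = 0 ∨ e = LinearMap.id := by
  refine and_congr_right fun _ => ⟨fun h e he => ?_, fun h p q hpq => ?_⟩
  · have hproj : LinearMap.IsProj (LinearMap.range e) e :=
      ⟨fun x => ⟨x, rfl⟩, by rintro _ ⟨x, rfl⟩; exact he x⟩
    refine (h _ _ hproj.isCompl).imp LinearMap.range_eq_bot.1 fun hker => ?_
    ext x
    exact LinearMap.ker_eq_bot.1 hker (he x)
  · refine (h (p.projection q hpq) fun x =>
      p.projection_apply_of_mem_left hpq (p.projection_apply_mem hpq x)).imp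
      (fun h0 => ?_) fun h1 => ?_
    · rw [← p.range_projection hpq, h0, LinearMap.range_zero]
    · rw [← p.ker_projection hpq, h1, LinearMap.ker_id]

theorem IsIndecomposable.congr (h : IsIndecomposable R M) (e : M ≃ₗ[R] N) :
    IsIndecomposable R N := by
  rw [isIndecomposable_iff] at h ⊢
  have := h.1
  refine ⟨e.symm.toEquiv.nontrivial, fun a ha => ?_⟩
  refine (h.2 (e.symm.toLinearMap ∘ₗ a ∘ₗ e.toLinearMap) fun x => by simp [ha]).imp
    (fun h0 => ?_) fun h1 => ?_
  · ext x
    simpa using LinearMap.congr_fun h0 (e.symm x)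
  · ext x
    simpa using congrArg e (LinearMap.congr_fun h1 (e.symm x))

/-- Basic modules, in terms of an external direct product decomposition. -/
theorem isBasic_iff : IsBasic R M ↔
    ∃ (n : ℕ) (N : Fin n → ModuleCat.{u} R), Nonempty (M ≃ₗ[R] ∀ i, N i) ∧
      (∀ i, IsIndecomposable R (N i)) ∧ ∀ i j, i ≠ j → IsEmpty (N i ≃ₗ[R] N j) := by
  constructor
  · rintro ⟨n, N, hN, h1, h2⟩
    exact ⟨n, fun i => ModuleCat.of R (N i),
      ⟨(LinearEquiv.ofBijective (DirectSum.coeLinearMap N) hN).symm.trans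
        (DirectSum.linearEquivFunOnFintype R (Fin n) fun i => N i)⟩, h1, h2⟩
  · rintro ⟨n, N, ⟨e⟩, h1, h2⟩
    let j : ∀ i, N i →ₗ[R] M := fun i => e.symm.toLinearMap ∘ₗ LinearMap.single R (fun i => N i) i
    have hj : ∀ i, Function.Injective (j i) := fun i _ _ hxy =>
      Pi.single_injective i (e.symm.injective hxy)
    let ε : ∀ i, N i ≃ₗ[R] LinearMap.range (j i) := fun i => LinearEquiv.ofInjective (j i) (hj i)
    refine ⟨n, fun i => LinearMap.range (j i),
      DirectSum.isInternal_submodule_of_iSupIndep_of_iSup_eq_top ?_ ?_,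
      fun i => (h1 i).congr (ε i),
      fun i k hik => ⟨fun f => (h2 i k hik).false ((ε i).trans (f.trans (ε k).symm))⟩⟩
    · intro i
      rw [Submodule.disjoint_def]
      rintro _ ⟨x, rfl⟩ hx
      have hle : (⨆ k, ⨆ (_ : k ≠ i), LinearMap.range (j k)) ≤
          LinearMap.ker (LinearMap.proj i ∘ₗ e.toLinearMap) := by
        refine iSup₂_le fun k hk => ?_
        rintro _ ⟨y, rfl⟩
        simp [j, Pi.single_eq_of_ne hk.symm]
      have hx0 : x = 0 := by simpa [j] using hle hx
      rw [hx0, map_zero]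
    · have : ∀ i, LinearMap.range (j i) =
          (LinearMap.range (LinearMap.single R (fun i => N i) i)).map e.symm.toLinearMap :=
        fun i => LinearMap.range_comp _ _
      simp only [this]
      rw [← Submodule.map_iSup, LinearMap.iSup_range_single, Submodule.map_top,
        LinearEquiv.range]

theorem IsBasic.congr (h : IsBasic R M) (e : M ≃ₗ[R] N) : IsBasic R N := by
  rw [isBasic_iff] at h ⊢
  obtain ⟨n, K, ⟨f⟩, h1, h2⟩ := h
  exact ⟨n, K, ⟨e.symm.trans f⟩, h1, h2⟩

theorem IsBasicTilting.congr (h : IsBasicTilting R M) (e : M ≃ₗ[R] N) : IsBasicTilting R N :=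
  ⟨h.isTilting.congr e, h.isBasic.congr e⟩

end Basic

section Duality

variable {A B : Type u} [Ring A] [Ring B] {T : Type u} [AddCommGroup T] [Module A T] [Module B T]
  [SMulCommClass A B T] [SMulCommClass B A T]
variable {X Y : Type u} [AddCommGroup X] [Module A X] [AddCommGroup Y] [Module A Y]

/-- On modules that agree with their double dual, duality is full. -/
theorem exists_dualMap_eq (hX : Function.Bijective (evalMap A B T X))
    (g : (X →ₗ[A] T) →ₗ[B] (Y →ₗ[A] T)) : ∃ f : Y →ₗ[A] X, dualMap B T f = g := by
  let E := LinearEquiv.ofBijective (evalMap A B T X) hX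
  refine ⟨E.symm.toLinearMap ∘ₗ dualMap A T g ∘ₗ evalMap A B T Y, ?_⟩
  ext a y
  exact LinearMap.congr_fun (E.apply_symm_apply (dualMap A T g (evalMap A B T Y y))) a

/-- On modules that agree with their double dual, duality is faithful. -/
theorem dualMap_injective (hX : Function.Bijective (evalMap A B T X)) {f g : Y →ₗ[A] X}
    (h : dualMap B T f = dualMap B T g) : f = g := by
  ext y
  refine hX.1 ?_
  ext a
  exact LinearMap.congr_fun (LinearMap.congr_fun h a) y

theorem IsIndecomposable.dual (h : IsIndecomposable A X)
    (hX : Function.Bijective (evalMap A B T X)) : IsIndecomposable B (X →ₗ[A] T) := by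
  rw [isIndecomposable_iff] at h ⊢
  refine ⟨?_, fun e he => ?_⟩
  · have := h.1
    by_contra hn
    rw [not_nontrivial_iff_subsingleton] at hn
    have := hX.1.nontrivial
    exact false_of_nontrivial_of_subsingleton ((X →ₗ[A] T) →ₗ[B] T)
  · obtain ⟨f, rfl⟩ := exists_dualMap_eq hX e
    have hf : f ∘ₗ f = f := dualMap_injective (B := B) hX (LinearMap.ext he)
    rcases h.2 f (LinearMap.congr_fun hf) with rfl | rfl
    · left
      ext a x
      simp
    · right
      rfl

theorem nonempty_equiv_of_dual (hX : Function.Bijective (evalMap A B T X))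
    (hY : Function.Bijective (evalMap A B T Y)) (e : (X →ₗ[A] T) ≃ₗ[B] (Y →ₗ[A] T)) :
    Nonempty (X ≃ₗ[A] Y) :=
  ⟨(LinearEquiv.ofBijective _ hX).trans
    ((dualEquiv A T e.symm).trans (LinearEquiv.ofBijective _ hY).symm)⟩

theorem IsBasic.dual (h : IsBasic A X) (hX : Function.Bijective (evalMap A B T X)) :
    IsBasic B (X →ₗ[A] T) := by
  obtain ⟨n, N, ⟨e⟩, h1, h2⟩ := isBasic_iff.1 h
  have hN : ∀ i, Function.Bijective (evalMap A B T (N i)) := fun i =>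
    bijective_evalMap_of_inAdd (inAdd_self.of_retract
      (e.symm.toLinearMap ∘ₗ LinearMap.single A (fun i => N i) i)
      (LinearMap.proj i ∘ₗ e.toLinearMap) fun x => by simp) hX
  refine isBasic_iff.2 ⟨n, fun i => ModuleCat.of B (N i →ₗ[A] T),
    ⟨(dualEquiv B T e.symm).trans (LinearMap.lsum A (fun i => N i) B).symm⟩,
    fun i => (h1 i).dual (hN i), fun i j hij => ⟨fun f => ?_⟩⟩
  exact (nonempty_equiv_of_dual (hN i) (hN j) f).elim (h2 i j hij).false

theorem IsTiltingBimodule.isBasicTilting_dual (h : IsTiltingBimodule A B T)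
    (hX : IsBasicTilting A X) (hXT : ExtOrthogonal A X T) : IsBasicTilting B (X →ₗ[A] T) :=
  ⟨h.isTilting_dual hX.isTilting hXT, hX.isBasic.dual
    (h.isDualizable ⟨hX.isTilting.finite, hX.isTilting.finProjDim, hXT⟩).bijective⟩

end Duality

/-! ### Intervals and convex hulls in Hasse diagrams -/

section Hulls

variable {A B : Type u} [Ring A] [Ring B] {s : TiltingClass A} {t : TiltingClass B}

theorem TiltingClass.le_of_path {x y : TiltingClass A} (p : Quiver.Path x y) : y ≤ x := by
  induction p with
  | nil => exact le_rfl
  | cons _ f ih => exact f.down.le.trans ih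

/-- Covers in an upper set are covers in the whole poset, hence an order reversing bijection of
upper sets reverses covers. -/
theorem covBy_of_orderIso (e : Set.Ici s ≃o (Set.Ici t)ᵒᵈ) {x y : Set.Ici s} (h : x.1 ⋖ y.1) :
    (OrderDual.ofDual (e y)).1 ⋖ (OrderDual.ofDual (e x)).1 := by
  refine ⟨(e.lt_iff_lt.2 h.1 : e x < e y), fun z hz hz' => ?_⟩
  have hzt : t ≤ z := (OrderDual.ofDual (e y)).2.trans hz.le
  obtain ⟨w, hw⟩ := e.surjective (OrderDual.toDual ⟨z, hzt⟩)
  have hz1 : e w < e y := by rw [hw]; exact hz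
  have hz2 : e x < e w := by rw [hw]; exact hz'
  exact h.2 (e.lt_iff_lt.1 hz2) (e.lt_iff_lt.1 hz1)

theorem nonempty_path_of_orderIso (e : Set.Ici s ≃o (Set.Ici t)ᵒᵈ) {x y : TiltingClass A}
    (p : Quiver.Path x y) (hx : s ≤ x) (hy : s ≤ y) :
    Nonempty (Quiver.Path (OrderDual.ofDual (e ⟨y, hy⟩)).1 (OrderDual.ofDual (e ⟨x, hx⟩)).1) := by
  induction p with
  | nil => exact ⟨.nil⟩
  | @cons b c p f ih =>
    have hb : s ≤ b := hy.trans f.down.le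
    obtain ⟨q⟩ := ih hb
    exact ⟨(Quiver.Hom.toPath
      (PLift.up (covBy_of_orderIso e (x := ⟨c, hy⟩) (y := ⟨b, hb⟩) f.down))).comp q⟩

/-- The convex hull of a set of classes above `s` is mapped to the convex hull of its image. -/
theorem mem_hullSet_of_orderIso (e : Set.Ici s ≃o (Set.Ici t)ᵒᵈ) {S : Set (TiltingClass A)}
    {S' : Set (TiltingClass B)} (hS : ∀ x ∈ S, ∃ hx : s ≤ x, (OrderDual.ofDual (e ⟨x, hx⟩)).1 ∈ S')
    {x : TiltingClass A} (hx : x ∈ hullSet S) :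
    ∃ hx : s ≤ x, (OrderDual.ofDual (e ⟨x, hx⟩)).1 ∈ hullSet S' := by
  refine hx {x | ∃ hx : s ≤ x, (OrderDual.ofDual (e ⟨x, hx⟩)).1 ∈ hullSet S'} ⟨fun y hy => ?_, ?_⟩
  · obtain ⟨h1, h2⟩ := hS y hy
    exact ⟨h1, subset_hullSet _ h2⟩
  · rintro a b y ⟨ha, ha'⟩ ⟨hb, hb'⟩ ⟨p⟩ ⟨q⟩
    have hy : s ≤ y := hb.trans (TiltingClass.le_of_path q)
    exact ⟨hy, fun C hC => hC.2 (hb' C hC) (ha' C hC) (nonempty_path_of_orderIso e q hy hb)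
      (nonempty_path_of_orderIso e p ha hy)⟩

section

variable (e : Set.Ici s ≃o (Set.Ici t)ᵒᵈ) {S : Set (TiltingClass A)}
    {S' : Set (TiltingClass B)} (hS : ∀ x ∈ S, ∃ hx : s ≤ x, (OrderDual.ofDual (e ⟨x, hx⟩)).1 ∈ S')

/-- The map on convex hulls induced by an order reversing bijection of upper sets. -/
def hullMap (x : ConvexHull S) : ConvexHull S' :=
  ⟨(OrderDual.ofDual (e ⟨x.1, (mem_hullSet_of_orderIso e hS x.2).1⟩)).1,
    (mem_hullSet_of_orderIso e hS x.2).2⟩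

/-- An arrow of a convex hull, reversed by an order reversing bijection of upper sets. -/
def hullMapHom {x y : ConvexHull S} (f : x ⟶ y) : hullMap e hS y ⟶ hullMap e hS x :=
  PLift.up (covBy_of_orderIso e (x := ⟨y.1, (mem_hullSet_of_orderIso e hS y.2).1⟩)
    (y := ⟨x.1, (mem_hullSet_of_orderIso e hS x.2).1⟩) (PLift.down f))

/-- The morphism of quivers from a convex hull to the opposite of a convex hull induced by an order
reversing bijection of upper sets. -/
def hullPrefunctor : ConvexHull S ⥤q (ConvexHull S')ᵒᵖ where
  obj x := Opposite.op (hullMap e hS x)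
  map f := (hullMapHom e hS f).op

theorem isQuiverIso_hullPrefunctor
    (hS' : ∀ y ∈ S', ∃ hy : t ≤ y, (e.symm (OrderDual.toDual ⟨y, hy⟩)).1 ∈ S) :
    IsQuiverIso (hullPrefunctor e hS) := by
  have hsub : ∀ {U : Set (TiltingClass A)} (a b : ConvexHull U), Subsingleton (a ⟶ b) :=
    fun a b => inferInstanceAs (Subsingleton (PLift (b.1 ⋖ a.1)))
  have hsub' : ∀ {U : Set (TiltingClass B)} (a b : (ConvexHull U)ᵒᵖ), Subsingleton (a ⟶ b) :=
    fun a b =>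
      have : Subsingleton (b.unop ⟶ a.unop) :=
        inferInstanceAs (Subsingleton (PLift (a.unop.1 ⋖ b.unop.1)))
      ⟨fun f g => Quiver.Hom.unop_inj (Subsingleton.elim f.unop g.unop)⟩
  let e' : Set.Ici t ≃o (Set.Ici s)ᵒᵈ := e.symm.dual
  let G : (ConvexHull S')ᵒᵖ ⥤q ConvexHull S :=
    { obj := fun y => hullMap e' hS' y.unop
      map := fun f => hullMapHom e' hS' f.unop }
  refine ⟨G, ?_, ?_⟩
  · fapply Prefunctor.ext
    · intro x
      have hx := (mem_hullSet_of_orderIso e hS x.2).1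
      have h : (e.symm (e ⟨x.1, hx⟩)).1 = x.1 := by rw [e.symm_apply_apply]
      exact Subtype.ext h
    · intro x y f
      exact (hsub _ _).elim _ _
  · fapply Prefunctor.ext
    · intro y
      have hy := (mem_hullSet_of_orderIso e' hS' y.unop.2).1
      have h : (OrderDual.ofDual (e (e.symm (OrderDual.toDual ⟨y.unop.1, hy⟩)))).1 = y.unop.1 := by
        rw [e.apply_symm_apply, OrderDual.ofDual_toDual]
      exact congrArg Opposite.op (Subtype.ext h)
    · intro x y f
      exact (hsub' _ _).elim _ _

end

end Hulls

/-! ### The duality of intervals of tilting modules -/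

section Intervals

variable {A B : Type u} [Ring A] [Ring B] {T : Type u} [AddCommGroup T] [Module A T] [Module B T]
  [SMulCommClass A B T] [SMulCommClass B A T]

theorem TiltingClass.exists_eq_mk (x : TiltingClass A) :
    ∃ (X : ModuleCat.{u} A) (hX : IsBasicTilting A X), x = TiltingClass.mk A X hX := by
  obtain ⟨M, rfl⟩ := Quotient.exists_rep x
  exact ⟨M.1, M.2, rfl⟩

namespace IsTiltingBimodule

/-- The class of `Hom_A(X, T)` for a class `X` above the class of `T`, computed on a chosen
representative. -/
noncomputable def dualClass (h : IsTiltingBimodule A B T) (hA : IsBasicTilting A T)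
    (hB : IsBasicTilting B T) (x : Set.Ici (TiltingClass.mk A T hA)) :
    Set.Ici (TiltingClass.mk B T hB) :=
  have hX := x.1.exists_eq_mk.choose_spec.choose
  have hXT : ExtOrthogonal A x.1.exists_eq_mk.choose T :=
    (TiltingClass.mk_le_mk_iff h.approx_left hA hX).1
      (x.2.trans_eq x.1.exists_eq_mk.choose_spec.choose_spec)
  ⟨TiltingClass.mk B (x.1.exists_eq_mk.choose →ₗ[A] T) (h.isBasicTilting_dual hX hXT),
    (TiltingClass.mk_le_mk_iff h.approx_right hB _).2
      (h.isDualizable ⟨hX.isTilting.finite, hX.isTilting.finProjDim, hXT⟩).dual_extOrthogonal⟩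

theorem dualClass_mk (h : IsTiltingBimodule A B T) (hA : IsBasicTilting A T)
    (hB : IsBasicTilting B T) {X : Type u} [AddCommGroup X] [Module A X] (hX : IsBasicTilting A X)
    (hTX : TiltingClass.mk A T hA ≤ TiltingClass.mk A X hX) :
    (h.dualClass hA hB ⟨_, hTX⟩).1 = TiltingClass.mk B (X →ₗ[A] T)
      (h.isBasicTilting_dual hX ((TiltingClass.mk_le_mk_iff h.approx_left hA hX).1 hTX)) := by
  have hs := (TiltingClass.mk A X hX).exists_eq_mk.choose_spec
  obtain ⟨e⟩ := (TiltingClass.mk_eq_mk_iff hX hs.choose).1 hs.choose_spec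
  exact (TiltingClass.mk_eq_mk_iff _ _).2 ⟨dualEquiv B T e⟩

theorem dualClass_antitone (h : IsTiltingBimodule A B T) (hA : IsBasicTilting A T)
    (hB : IsBasicTilting B T) : Antitone (h.dualClass hA hB) := by
  rintro ⟨x, hx⟩ ⟨y, hy⟩ hxy
  obtain ⟨X, hX, rfl⟩ := x.exists_eq_mk
  obtain ⟨Y, hY, rfl⟩ := y.exists_eq_mk
  rw [← Subtype.coe_le_coe, h.dualClass_mk hA hB hX hx, h.dualClass_mk hA hB hY hy,
    TiltingClass.mk_le_mk_iff h.approx_right]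
  exact h.extOrthogonal_dual
    ⟨hY.isTilting.finite, hY.isTilting.finProjDim,
      (TiltingClass.mk_le_mk_iff h.approx_left hA hY).1 hy⟩
    ⟨hX.isTilting.finite, hX.isTilting.finProjDim,
      (TiltingClass.mk_le_mk_iff h.approx_left hA hX).1 hx⟩
    ((TiltingClass.mk_le_mk_iff h.approx_left hX hY).1 hxy)

theorem dualClass_dualClass (h : IsTiltingBimodule A B T) (hA : IsBasicTilting A T)
    (hB : IsBasicTilting B T) (x : Set.Ici (TiltingClass.mk A T hA)) :
    h.symm.dualClass hB hA (h.dualClass hA hB x) = x := by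
  obtain ⟨x, hx⟩ := x
  obtain ⟨X, hX, rfl⟩ := x.exists_eq_mk
  have hXT := (TiltingClass.mk_le_mk_iff h.approx_left hA hX).1 hx
  have hd : h.dualClass hA hB ⟨_, hx⟩ = ⟨_, (h.dualClass_mk hA hB hX hx) ▸
      (h.dualClass hA hB ⟨_, hx⟩).2⟩ := Subtype.ext (h.dualClass_mk hA hB hX hx)
  rw [hd]
  refine Subtype.ext ((h.symm.dualClass_mk hB hA _ _).trans ?_)
  exact (TiltingClass.mk_eq_mk_iff _ _).2
    ⟨(h.evalEquiv ⟨hX.isTilting.finite, hX.isTilting.finProjDim, hXT⟩).symm⟩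

/-- Duality is an order reversing bijection between the classes above `T` on either side. -/
noncomputable def dualOrderIso (h : IsTiltingBimodule A B T) (hA : IsBasicTilting A T)
    (hB : IsBasicTilting B T) :
    Set.Ici (TiltingClass.mk A T hA) ≃o (Set.Ici (TiltingClass.mk B T hB))ᵒᵈ where
  toFun x := OrderDual.toDual (h.dualClass hA hB x)
  invFun y := h.symm.dualClass hB hA (OrderDual.ofDual y)
  left_inv := h.dualClass_dualClass hA hB
  right_inv := h.symm.dualClass_dualClass hB hA
  map_rel_iff' {x y} := by
    refine ⟨fun hxy => ?_, fun hxy => h.dualClass_antitone hA hB hxy⟩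
    rw [← h.dualClass_dualClass hA hB x, ← h.dualClass_dualClass hA hB y]
    exact h.symm.dualClass_antitone hB hA hxy

end IsTiltingBimodule

theorem TiltingClass.le_mk_self (hR : HasFiniteApproximations A) (hA : IsBasicTilting A A)
    (hT : IsBasicTilting A T) : TiltingClass.mk A T hT ≤ TiltingClass.mk A A hA :=
  (TiltingClass.mk_le_mk_iff hR hT hA).2 extOrthogonal_of_projective

end Intervals

end TiltingQuiver

open TiltingQuiver in
theorem theorem4p5 {k : Type v} [Field k] [IsAlgClosed k]
    {A : Type u} [Ring A] [Algebra k A] [FiniteDimensional k A]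
    (hconn : TiltingQuiver.IsConnectedRing A) (hbasic : TiltingQuiver.IsBasic A A)
    {T : Type u} [AddCommGroup T] [Module A T] (hT : TiltingQuiver.IsBasicTilting A T) :
    ∃ (hAA : TiltingQuiver.IsBasicTilting A A)
      (hBB : TiltingQuiver.IsBasicTilting (Module.End A T) (Module.End A T))
      (hBT : TiltingQuiver.IsBasicTilting (Module.End A T) T)
      (α : TiltingQuiver.ConvexHull
            {TiltingQuiver.TiltingClass.mk A A hAA, TiltingQuiver.TiltingClass.mk A T hT} ⥤q
          (TiltingQuiver.ConvexHull
            {TiltingQuiver.TiltingClass.mk (Module.End A T) (Module.End A T) hBB,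
              TiltingQuiver.TiltingClass.mk (Module.End A T) T hBT})ᵒᵖ),
      TiltingQuiver.IsQuiverIso α ∧
      (∀ (X : Type u) [AddCommGroup X] [Module A X] (hX : TiltingQuiver.IsBasicTilting A X)
        (hmem : TiltingQuiver.TiltingClass.mk A X hX ∈ TiltingQuiver.hullSet
          {TiltingQuiver.TiltingClass.mk A A hAA, TiltingQuiver.TiltingClass.mk A T hT}),
        ∃ hXT : TiltingQuiver.IsBasicTilting (Module.End A T) (X →ₗ[A] T),
          (α.obj ⟨TiltingQuiver.TiltingClass.mk A X hX, hmem⟩).unop.1 =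
            TiltingQuiver.TiltingClass.mk (Module.End A T) (X →ₗ[A] T) hXT) ∧
      (α.obj ⟨TiltingQuiver.TiltingClass.mk A A hAA,
          TiltingQuiver.subset_hullSet _ (Set.mem_insert _ _)⟩).unop.1 =
        TiltingQuiver.TiltingClass.mk (Module.End A T) T hBT ∧
      (α.obj ⟨TiltingQuiver.TiltingClass.mk A T hT,
          TiltingQuiver.subset_hullSet _ (Set.mem_insert_of_mem _ rfl)⟩).unop.1 =
        TiltingQuiver.TiltingClass.mk (Module.End A T) (Module.End A T) hBB := by
  have hA := hasFiniteApproximations_of_finiteDimensional k A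
  have := hT.isTilting.finite
  obtain ⟨hB, hfin⟩ := hasFiniteApproximations_end k (R := A) T
  have hbal : IsBalanced A (Module.End A T) T := Function.bijective_id
  have h := hT.isTilting.isTiltingBimodule hA hB hfin hbal
  have hAA : IsBasicTilting A A := ⟨isTilting_self A, hbasic⟩
  have hBB : IsBasicTilting (Module.End A T) (Module.End A T) :=
    (h.isBasicTilting_dual hT h.extOrthogonal_left).congr hbal.equiv.symm
  have hBT : IsBasicTilting (Module.End A T) T :=
    (h.isBasicTilting_dual hAA extOrthogonal_of_projective).congr (regularDual A _ T)
  have hTA := TiltingClass.le_mk_self hA hAA hT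
  have hTB := TiltingClass.le_mk_self hB hBB hBT
  have imA : (h.dualClass hT hBT ⟨_, hTA⟩).1 = TiltingClass.mk _ T hBT :=
    (h.dualClass_mk hT hBT hAA hTA).trans
      ((TiltingClass.mk_eq_mk_iff _ _).2 ⟨regularDual A _ T⟩)
  have imT : (h.dualClass hT hBT ⟨_, Set.self_mem_Ici⟩).1 = TiltingClass.mk _ _ hBB :=
    (h.dualClass_mk hT hBT hT le_rfl).trans
      ((TiltingClass.mk_eq_mk_iff _ _).2 ⟨hbal.equiv.symm⟩)
  let e := h.dualOrderIso hT hBT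
  have hS : ∀ x ∈ ({TiltingClass.mk A A hAA, TiltingClass.mk A T hT} : Set (TiltingClass A)),
      ∃ hx : TiltingClass.mk A T hT ≤ x, (OrderDual.ofDual (e ⟨x, hx⟩)).1 ∈
        ({TiltingClass.mk _ _ hBB, TiltingClass.mk _ T hBT} :
          Set (TiltingClass (Module.End A T))) := by
    rintro x (rfl | rfl)
    · exact ⟨hTA, Or.inr imA⟩
    · exact ⟨le_rfl, Or.inl imT⟩
  refine ⟨hAA, hBB, hBT, hullPrefunctor e hS, isQuiverIso_hullPrefunctor e hS ?_,
    fun X _ _ hX hmem => ⟨_, h.dualClass_mk hT hBT hX (mem_hullSet_of_orderIso e hS hmem).1⟩,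
    imA, imT⟩
  rintro y (rfl | rfl)
  · refine ⟨hTB, Or.inr ?_⟩
    have : OrderDual.toDual ⟨_, hTB⟩ = e ⟨_, Set.self_mem_Ici⟩ := congrArg OrderDual.toDual
      (Subtype.ext imT.symm)
    rw [this, e.symm_apply_apply]
    rfl
  · refine ⟨le_rfl, Or.inl ?_⟩
    have : OrderDual.toDual ⟨_, Set.self_mem_Ici⟩ = e ⟨_, hTA⟩ := congrArg OrderDual.toDual
      (Subtype.ext imA.symm)
    rw [this, e.symm_apply_apply]
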